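/- All rings are associative with identity, and ring homomorphisms preserve the identity. A ring $R$ with center $C(R)$ is called centrally essential if either $R$ is commutative or for every non-central element $a\in R$ there exist non-zero elements $x,y\in C(R)$ with $ax=y$. A ring $R$ is a subdirect product of rings $R_i$, $i\in I$, if there is an injective ring homomorphism $R\to\prod_{i\in I}R_i$ whose composition with each coordinate projection $\prod_{j\in I}R_j\to R_i$ is surjective. Theorem 1.5. Let $R$ be a right Noetherian ring such that the factor ring $R/I$ is centrally essential for every two-sided ideal $I$ of $R$. Then $R$ is a subdirect product of a family of local rings (not necessarily commutative), each of which is both right Artinian and left Artinian. -/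

import Mathlib

universe u

/-- A ring is centrally essential if it is commutative, or for every non-central element `a`
there are non-zero central elements `x`, `y` with `a * x = y`. -/
def IsCentrallyEssential (R : Type*) [Ring R] : Prop :=
  (∀ a b : R, a * b = b * a) ∨
    ∀ a : R, a ∉ Subring.center R →
      ∃ x ∈ Subring.center R, ∃ y ∈ Subring.center R, x ≠ 0 ∧ y ≠ 0 ∧ a * x = y

/-- `R` is a subdirect product of the rings `S i`: it embeds in their product so that every
coordinate projection restricted to `R` is surjective. -/
def IsSubdirectProduct (R : Type*) [Ring R] {ι : Type*} (S : ι → Type*) [∀ i, Ring (S i)] : Prop :=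
  ∃ f : R →+* (∀ i, S i), Function.Injective f ∧ ∀ i, Function.Surjective (fun r => f r i)

/-- The right regular module, that is, `R` as a module over `Rᵐᵒᵖ`, satisfies the ascending chain
condition. -/
def IsRightNoetherian (R : Type*) [Ring R] : Prop := IsNoetherian Rᵐᵒᵖ R

/-- The right regular module satisfies the descending chain condition. -/
def IsRightArtinian (R : Type*) [Ring R] : Prop := IsArtinian Rᵐᵒᵖ R

/-- The left regular module satisfies the descending chain condition. -/
def IsLeftArtinian (R : Type*) [Ring R] : Prop := IsArtinian R R

/-!
The two-sided ideals of `R` that are maximal among those avoiding a given nonzero element exhibit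
`R` as a subdirect product of factor rings `S` in which some nonzero element lies in every nonzero
two-sided ideal. It remains to see that such an `S` is local and Artinian on both sides.

Central essentiality provides a nonzero central `y` in every nonzero two-sided ideal of `S`. Let
`M` be its annihilator. If `x ∉ M` is central modulo `M`, then `y x S` is a nonzero two-sided
ideal, hence contains `y`, and `x` is invertible modulo `M`. As the elements of `S` become central
modulo `M` after multiplication by such an `x`, the ring `S / M` is a field
(`exists_mul_sub_one_mem`).

The main point is that `M` is nilpotent (`exists_pow_eq_bot`), an Artin–Rees type argument. Every
inclusion `I < J` of two-sided ideals admits an element of `J \ I` that is central modulo `I`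
(`FactorsCentrallyEssential.exists_isCentralModulo`). By Noetherian induction on `I ≤ M`, the left
annihilator `V` of `I` is annihilated by a power of `M`: take `c ∈ M \ I` central modulo `I`. Right
multiplication by `c` is a bimodule endomorphism of `V`, so for large `n` the set `V c ^ n` is an
ideal meeting the kernel of `c` trivially. Since `y c = 0`, this forces `V c ^ n = 0`, and the
kernel of `c` on `V` is the left annihilator of `I + S c`, to which the induction applies. The case
`I = 0` is the nilpotency of `M`.

Finally, as `M` is nilpotent, each proper two-sided ideal `I` admits `c ∉ I` central modulo `I`
with `M c ⊆ I`. Then `(I + S c) / I` is simple both as a left and as a right module, so a maximal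
two-sided ideal of finite length on both sides is the whole ring.
-/

/-! ### Elements central modulo an ideal -/

/-- The image of `c` in `R ⧸ I` is central. -/
def IsCentralModulo {R : Type*} [Ring R] (I : Ideal R) (c : R) : Prop :=
  ∀ r, c * r - r * c ∈ I

/-- Central essentiality of all factor rings of `R`, expressed by elements of `R`. The product
`a * x` plays the role of the nonzero central element `y = a x` of the definition, and for `a`
central modulo `I` the choice `x = 1` is available, so no case distinction is needed. -/
def FactorsCentrallyEssential (R : Type*) [Ring R] : Prop :=
  ∀ (I : Ideal R) [I.IsTwoSided], ∀ a ∉ I,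
    ∃ x, IsCentralModulo I x ∧ IsCentralModulo I (a * x) ∧ a * x ∉ I

section

variable {R : Type*} [Ring R]

theorem IsCentrallyEssential.exists_mul_mem_center (h : IsCentrallyEssential R) {a : R}
    (ha : a ≠ 0) : ∃ x ∈ Subring.center R, a * x ∈ Subring.center R ∧ a * x ≠ 0 := by
  by_cases hc : a ∈ Subring.center R
  · exact ⟨1, one_mem _, by simpa using hc, by simpa using ha⟩
  · rcases h with h | h
    · exact absurd (Subring.mem_center_iff.2 fun b => h b a) hc
    · obtain ⟨x, hx, y, hy, -, hy0, rfl⟩ := h a hc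
      exact ⟨x, hx, hy, hy0⟩

theorem isCentralModulo_iff_mk_mem_center {I : Ideal R} [I.IsTwoSided] {c : R} :
    IsCentralModulo I c ↔ Ideal.Quotient.mk I c ∈ Subring.center (R ⧸ I) := by
  rw [Subring.mem_center_iff, (Ideal.Quotient.mk_surjective (I := I)).forall]
  refine forall_congr' fun r => ?_
  rw [← map_mul, ← map_mul, eq_comm, Ideal.Quotient.mk_eq_mk_iff_sub_mem]

theorem factorsCentrallyEssential_of_quotients
    (h : ∀ (I : Ideal R) [I.IsTwoSided], IsCentrallyEssential (R ⧸ I)) :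
    FactorsCentrallyEssential R := by
  intro I _ a ha
  obtain ⟨x, hx, hax, hne⟩ := (h I).exists_mul_mem_center
    (a := Ideal.Quotient.mk I a) (by rwa [Ne, Ideal.Quotient.eq_zero_iff_mem])
  obtain ⟨x, rfl⟩ := Ideal.Quotient.mk_surjective x
  rw [← map_mul] at hax hne
  rw [Ne, Ideal.Quotient.eq_zero_iff_mem] at hne
  exact ⟨x, isCentralModulo_iff_mk_mem_center.2 hx, isCentralModulo_iff_mk_mem_center.2 hax, hne⟩

theorem FactorsCentrallyEssential.of_surjective {S : Type*} [Ring S]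
    (h : FactorsCentrallyEssential R) (f : R →+* S) (hf : Function.Surjective f) :
    FactorsCentrallyEssential S := by
  intro I _ a ha
  obtain ⟨a, rfl⟩ := hf a
  have hcomap : ∀ {c : R}, IsCentralModulo (I.comap f) c → IsCentralModulo I (f c) := by
    intro c hc s
    obtain ⟨r, rfl⟩ := hf s
    simpa [Ideal.mem_comap] using hc r
  obtain ⟨x, hx, hax, hne⟩ := h (I.comap f) a ha
  refine ⟨f x, hcomap hx, ?_, ?_⟩
  · simpa using hcomap hax
  · simpa [Ideal.mem_comap] using hne

theorem FactorsCentrallyEssential.exists_isCentralModulo (h : FactorsCentrallyEssential R)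
    {I J : Ideal R} [I.IsTwoSided] [J.IsTwoSided] (hJI : ¬ J ≤ I) :
    ∃ c ∈ J, c ∉ I ∧ IsCentralModulo I c := by
  obtain ⟨a, haJ, haI⟩ := SetLike.not_le_iff_exists.1 hJI
  obtain ⟨x, -, hax, hne⟩ := h I a haI
  exact ⟨a * x, J.mul_mem_right _ haJ, hne, hax⟩

theorem IsCentralModulo.isTwoSided_span_sup {I : Ideal R} [I.IsTwoSided] {c : R}
    (hc : IsCentralModulo I c) : (Ideal.span {c} ⊔ I).IsTwoSided := by
  refine ⟨fun b ha => ?_⟩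
  obtain ⟨s, i, hi, rfl⟩ := Ideal.mem_span_singleton_sup.1 ha
  refine Ideal.mem_span_singleton_sup.2
    ⟨s * b, s * (c * b - b * c) + i * b, ?_, by noncomm_ring⟩
  exact add_mem (I.mul_mem_left _ (hc b)) (I.mul_mem_right _ hi)

/-! ### Noetherian induction on two-sided ideals -/

/-- A two-sided ideal, which Mathlib's `Ideal` views as a left ideal, viewed as a right ideal. -/
def Ideal.toRight (I : Ideal R) [I.IsTwoSided] : Submodule Rᵐᵒᵖ R where
  carrier := I
  add_mem' := I.add_mem
  zero_mem' := I.zero_mem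
  smul_mem' r _ hx := I.mul_mem_right r.unop hx

@[simp]
theorem Ideal.mem_toRight {I : Ideal R} [I.IsTwoSided] {x : R} : x ∈ I.toRight ↔ x ∈ I :=
  Iff.rfl

theorem IsRightNoetherian.twoSided_induction (hR : IsRightNoetherian R) {P : Ideal R → Prop}
    (step : ∀ (I : Ideal R) [I.IsTwoSided],
      (∀ (J : Ideal R) [J.IsTwoSided], I < J → P J) → P I)
    (I : Ideal R) [hI : I.IsTwoSided] : P I := by
  have : IsNoetherian Rᵐᵒᵖ R := hR
  have key : ∀ K : Submodule Rᵐᵒᵖ R, ∀ (I : Ideal R) [I.IsTwoSided], I.toRight = K → P I := by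
    intro K
    induction K using WellFoundedGT.induction with
    | ind K ih =>
      rintro I _ rfl
      exact step I fun J _ hIJ => ih J.toRight hIJ J rfl
  exact key _ I rfl

theorem IsRightNoetherian.of_surjective {S : Type*} [Ring S] (hR : IsRightNoetherian R)
    (f : R →+* S) (hf : Function.Surjective f) : IsRightNoetherian S := by
  have : IsNoetherian Rᵐᵒᵖ R := hR
  have : RingHomSurjective (RingHom.op f) :=
    ⟨fun s => (hf s.unop).elim fun r hr => ⟨MulOpposite.op r, congrArg MulOpposite.op hr⟩⟩
  let g : R →ₛₗ[RingHom.op f] S :=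
    { toFun := f
      map_add' := map_add f
      map_smul' := fun r x => by
        change f (x * r.unop) = f x * f r.unop
        exact map_mul f _ _ }
  exact isNoetherian_of_surjective g (LinearMap.range_eq_top.2 hf)

/-! ### The residue field and the nilpotency of the annihilator -/

/-- The left annihilator of an element; it is a two-sided ideal for a central element. -/
abbrev leftAnnihilator (y : R) : Ideal R := LinearMap.ker (LinearMap.toSpanSingleton R R y)

theorem mem_leftAnnihilator {r y : R} : r ∈ leftAnnihilator y ↔ r * y = 0 := by
  simp [leftAnnihilator]

theorem isTwoSided_leftAnnihilator {y : R} (hy : y ∈ Subring.center R) :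
    (leftAnnihilator y).IsTwoSided := by
  refine ⟨fun {a} b ha => ?_⟩
  rw [mem_leftAnnihilator] at ha ⊢
  rw [mul_assoc, Subring.mem_center_iff.1 hy b, ← mul_assoc, ha, zero_mul]

variable {y : R} (hy : y ∈ Subring.center R) (hy0 : y ≠ 0)
  (hmin : ∀ (I : Ideal R) [I.IsTwoSided], I ≠ ⊥ → y ∈ I)

include hy hmin in
theorem exists_mul_sub_one_mem_of_isCentralModulo {x : R}
    (hx : IsCentralModulo (leftAnnihilator y) x) (hxM : x ∉ leftAnnihilator y) :
    ∃ s, s * x - 1 ∈ leftAnnihilator y := by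
  have hyc := Subring.mem_center_iff.1 hy
  have htwo : (Ideal.span {x * y}).IsTwoSided := by
    refine ⟨fun b ha => ?_⟩
    obtain ⟨s, rfl⟩ := Ideal.mem_span_singleton'.1 ha
    refine Ideal.mem_span_singleton'.2 ⟨s * b, ?_⟩
    have := mem_leftAnnihilator.1 (hx b)
    rw [sub_mul, sub_eq_zero] at this
    simp only [mul_assoc] at this ⊢
    rw [← this, hyc b]
  have hne : Ideal.span {x * y} ≠ ⊥ := fun h => hxM <|
    mem_leftAnnihilator.2 (Ideal.span_singleton_eq_bot.1 h)
  obtain ⟨s, hs⟩ := Ideal.mem_span_singleton'.1 (hmin _ hne)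
  exact ⟨s, mem_leftAnnihilator.2 (by rw [sub_mul, mul_assoc, hs, one_mul, sub_self])⟩

include hy hmin in
theorem isCentralModulo_leftAnnihilator (hce : FactorsCentrallyEssential R) (a : R) :
    IsCentralModulo (leftAnnihilator y) a := by
  have := isTwoSided_leftAnnihilator hy
  set M := leftAnnihilator y
  intro b
  by_cases ha : a ∈ M
  · exact sub_mem (M.mul_mem_right _ ha) (M.mul_mem_left _ ha)
  obtain ⟨x, hx, hax, hne⟩ := hce M a ha
  obtain ⟨s, hs⟩ := exists_mul_sub_one_mem_of_isCentralModulo hy hmin hx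
    (fun h => hne (M.mul_mem_left _ h))
  -- The commutator of `a` and `b` is annihilated by `x` modulo `M`, and `x` is invertible there.
  have h1 : (a * b - b * a) * x ∈ M := by
    have : (a * b - b * a) * x = (a * x * b - b * (a * x)) - a * (x * b - b * x) := by
      noncomm_ring
    rw [this]
    exact sub_mem (hax b) (M.mul_mem_left _ (hx b))
  have h2 : a * b - b * a = (a * b - b * a) * x * s
      - (a * b - b * a) * (x * s - s * x) - (a * b - b * a) * (s * x - 1) := by
    noncomm_ring
  rw [h2]
  exact sub_mem (sub_mem (M.mul_mem_right _ h1) (M.mul_mem_left _ (hx s))) (M.mul_mem_left _ hs)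

include hy hmin in
/-- The factor ring by the annihilator of `y` is a field: every element outside the annihilator is
invertible modulo it, on both sides. -/
theorem exists_mul_sub_one_mem (hce : FactorsCentrallyEssential R) {x : R}
    (hx : x ∉ leftAnnihilator y) :
    ∃ s, s * x - 1 ∈ leftAnnihilator y ∧ x * s - 1 ∈ leftAnnihilator y := by
  have hc := isCentralModulo_leftAnnihilator hy hmin hce x
  obtain ⟨s, hs⟩ := exists_mul_sub_one_mem_of_isCentralModulo hy hmin hc hx
  exact ⟨s, hs, by simpa using add_mem (hc s) hs⟩

/-- On the left annihilator of `I`, right multiplication by an element central modulo `I` is right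
`R`-linear. -/
theorem IsCentralModulo.mul_pow_comm {I : Ideal R} [I.IsTwoSided] {c : R}
    (hc : IsCentralModulo I c) {v : R} (hv : ∀ i ∈ I, v * i = 0) (r : R) (n : ℕ) :
    v * r * c ^ n = v * c ^ n * r := by
  induction n with
  | zero => simp
  | succ n ih =>
    have := hv _ (I.mul_mem_left (c ^ n) (hc r))
    rw [mul_sub, mul_sub, sub_eq_zero] at this
    calc v * r * c ^ (n + 1) = v * r * c ^ n * c := by rw [pow_succ]; noncomm_ring
      _ = v * (c ^ n * (r * c)) := by rw [ih]; noncomm_ring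
      _ = v * c ^ (n + 1) * r := by rw [← this, pow_succ]; noncomm_ring

include hy0 hmin in
/-- A Fitting argument: right multiplication by `c` is nilpotent on the left annihilator of `I`,
because it kills `y`, which lies in every nonzero two-sided ideal. -/
theorem IsCentralModulo.exists_mul_pow_eq_zero (hR : IsRightNoetherian R) {I : Ideal R}
    [I.IsTwoSided] {c : R} (hc : IsCentralModulo I c) (hyc : y * c = 0) :
    ∃ n, ∀ v, (∀ i ∈ I, v * i = 0) → v * c ^ n = 0 := by
  have : IsNoetherian Rᵐᵒᵖ R := hR
  have hmul : ∀ {v : R}, (∀ i ∈ I, v * i = 0) → ∀ r, ∀ i ∈ I, v * r * i = 0 := fun hv r i hi => by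
    rw [mul_assoc]; exact hv _ (I.mul_mem_left r hi)
  let K : ℕ →o Submodule Rᵐᵒᵖ R :=
    { toFun := fun n =>
        { carrier := {v | (∀ i ∈ I, v * i = 0) ∧ v * c ^ n = 0}
          add_mem' := fun {v w} hv hw => ⟨fun i hi => by rw [add_mul, hv.1 i hi, hw.1 i hi, add_zero],
            by rw [add_mul, hv.2, hw.2, add_zero]⟩
          zero_mem' := ⟨fun _ _ => zero_mul _, zero_mul _⟩
          smul_mem' := fun r v hv => ⟨hmul hv.1 r.unop, by
            change v * r.unop * c ^ n = 0
            rw [hc.mul_pow_comm hv.1, hv.2, zero_mul]⟩ }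
      monotone' := fun m n hmn v hv => ⟨hv.1, by
        rw [← Nat.add_sub_cancel' hmn, pow_add, ← mul_assoc, hv.2, zero_mul]⟩ }
  obtain ⟨n, hn⟩ := monotone_stabilizes_iff_noetherian.2 this K
  refine ⟨n, ?_⟩
  let L : Ideal R :=
    { carrier := {w | ∃ v, (∀ i ∈ I, v * i = 0) ∧ v * c ^ n = w}
      add_mem' := by
        rintro _ _ ⟨v, hv, rfl⟩ ⟨w, hw, rfl⟩
        exact ⟨v + w, fun i hi => by rw [add_mul, hv i hi, hw i hi, add_zero], add_mul _ _ _⟩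
      zero_mem' := ⟨0, fun _ _ => zero_mul _, zero_mul _⟩
      smul_mem' := by
        rintro r _ ⟨v, hv, rfl⟩
        exact ⟨r * v, fun i hi => by rw [mul_assoc, hv i hi, mul_zero], mul_assoc _ _ _⟩ }
  have hL : L.IsTwoSided := by
    refine ⟨?_⟩
    rintro _ b ⟨v, hv, rfl⟩
    exact ⟨v * b, hmul hv b, hc.mul_pow_comm hv b n⟩
  have hbot : L = ⊥ := by
    by_contra hne
    obtain ⟨v, hv, hvy⟩ := hmin L hne
    have h1 : v ∈ K (n + 1) := ⟨hv, by rw [pow_succ, ← mul_assoc, hvy, hyc]⟩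
    rw [← hn (n + 1) n.le_succ] at h1
    exact hy0 (hvy.symm.trans h1.2)
  intro v hv
  have : v * c ^ n ∈ L := ⟨v, hv, rfl⟩
  rwa [hbot, Ideal.mem_bot] at this

include hy hy0 hmin in
theorem exists_mul_eq_zero_of_mem_pow (hR : IsRightNoetherian R)
    (hce : FactorsCentrallyEssential R) (I : Ideal R) [I.IsTwoSided]
    (hIM : I ≤ leftAnnihilator y) :
    ∃ k, ∀ v, (∀ i ∈ I, v * i = 0) → ∀ w ∈ leftAnnihilator y ^ k, v * w = 0 := by
  have := isTwoSided_leftAnnihilator hy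
  set M := leftAnnihilator y with hM
  revert hIM
  refine hR.twoSided_induction (P := fun I => I ≤ M →
    ∃ k, ∀ v, (∀ i ∈ I, v * i = 0) → ∀ w ∈ M ^ k, v * w = 0) ?_ I
  intro I _ ih hIM
  by_cases hMI : M ≤ I
  · exact ⟨1, fun v hv w hw => hv w (hMI (by rwa [Submodule.pow_one] at hw))⟩
  obtain ⟨c, hcM, hcI, hc⟩ := hce.exists_isCentralModulo hMI
  have hyc : y * c = 0 := by
    rw [← Subring.mem_center_iff.1 hy c]; exact mem_leftAnnihilator.1 hcM
  have := hc.isTwoSided_span_sup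
  obtain ⟨k, hk⟩ := ih (Ideal.span {c} ⊔ I)
    (lt_of_le_of_ne le_sup_right fun h =>
      hcI (h ▸ Submodule.mem_sup_left (Ideal.mem_span_singleton_self c)))
    (sup_le ((Ideal.span_singleton_le_iff_mem M).2 hcM) hIM)
  obtain ⟨n, hn⟩ := hc.exists_mul_pow_eq_zero hy0 hmin hR hyc
  have key : ∀ j v, (∀ i ∈ I, v * i = 0) → v * c ^ j = 0 → ∀ w ∈ M ^ (k * j), v * w = 0 := by
    intro j
    induction j with
    | zero =>
      intro v _ hv w _
      rw [pow_zero, mul_one] at hv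
      rw [hv, zero_mul]
    | succ j ihj =>
      intro v hv hvc w hw
      rw [Nat.mul_succ, add_comm, Ideal.IsTwoSided.pow_add] at hw
      refine Submodule.smul_induction_on hw (fun a ha b hb => ?_) fun a b ha hb => by
        rw [mul_add, ha, hb, add_zero]
      rw [smul_eq_mul, ← mul_assoc]
      refine ihj (v * a) (fun i hi => by rw [mul_assoc]; exact hv _ (I.mul_mem_left a hi)) ?_ b hb
      -- `v * c ^ j` is annihilated by `c` and by `I`, so the induction hypothesis for `I + R c` applies.
      rw [hc.mul_pow_comm hv]
      refine hk _ (fun x hx => ?_) a ha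
      obtain ⟨s, i, hi, rfl⟩ := Ideal.mem_span_singleton_sup.1 hx
      have h1 : v * c ^ j * (s * c) = 0 := by
        rw [← mul_assoc, ← hc.mul_pow_comm hv, mul_assoc, ← pow_succ, hc.mul_pow_comm hv, hvc,
          zero_mul]
      rw [mul_add, h1, zero_add, mul_assoc]
      exact hv _ (I.mul_mem_left _ hi)
  exact ⟨k * n, fun v hv => key n v hv (hn v hv)⟩

include hy hy0 hmin in
theorem exists_pow_eq_bot (hR : IsRightNoetherian R) (hce : FactorsCentrallyEssential R) :
    ∃ k, leftAnnihilator y ^ k = ⊥ := by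
  obtain ⟨k, hk⟩ := exists_mul_eq_zero_of_mem_pow hy hy0 hmin hR hce ⊥ bot_le
  refine ⟨k, (Submodule.eq_bot_iff _).2 fun w hw => ?_⟩
  simpa using hk 1 (by simp) w hw

/-! ### Locality -/

theorem isUnit_of_isNilpotent_mul_sub_one {x s : R} (h1 : IsNilpotent (s * x - 1))
    (h2 : IsNilpotent (x * s - 1)) : IsUnit x := by
  have h1 : IsUnit (s * x) := by simpa using h1.isUnit_add_one
  have h2 : IsUnit (x * s) := by simpa using h2.isUnit_add_one
  obtain ⟨a, ha⟩ := h1.exists_left_inv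
  obtain ⟨b, hb⟩ := h2.exists_right_inv
  exact isUnit_iff_exists_and_exists.2
    ⟨⟨s * b, by rw [← mul_assoc, hb]⟩, ⟨a * s, by rw [mul_assoc, ha]⟩⟩

include hy hy0 hmin in
theorem isLocalRing_of_mem_ideals (hR : IsRightNoetherian R) (hce : FactorsCentrallyEssential R) :
    IsLocalRing R := by
  have : Nontrivial R := ⟨y, 0, hy0⟩
  obtain ⟨k, hk⟩ := exists_pow_eq_bot hy hy0 hmin hR hce
  have hnil : ∀ m ∈ leftAnnihilator y, IsNilpotent m := fun m hm =>
    ⟨k, by simpa [hk] using Ideal.pow_mem_pow hm k⟩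
  have hunit : ∀ x ∉ leftAnnihilator y, IsUnit x := fun x hx => by
    obtain ⟨s, h1, h2⟩ := exists_mul_sub_one_mem hy hmin hce hx
    exact isUnit_of_isNilpotent_mul_sub_one (hnil _ h1) (hnil _ h2)
  refine ⟨fun {a b} hab => ?_⟩
  by_contra! h
  have ha := not_imp_comm.1 (hunit a) h.1
  have hb := not_imp_comm.1 (hunit b) h.2
  have := mem_leftAnnihilator.1 (hab ▸ add_mem ha hb)
  exact hy0 (by simpa using this)

/-! ### Finite length -/

theorem IsFiniteLength.of_covBy {T V : Type*} [Ring T] [AddCommGroup V] [Module T V]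
    {A B : Submodule T V} (hA : IsFiniteLength T A) (hAB : A ⋖ B) : IsFiniteLength T B := by
  have := (covBy_iff_quot_is_simple hAB.le).1 hAB
  exact .of_simple_quotient ((Submodule.comapSubtypeEquivOfLe hAB.le).symm.isFiniteLength hA)

include hy hmin in
theorem covBy_span_sup (hce : FactorsCentrallyEssential R) {I : Ideal R} {c : R}
    (hcI : c ∉ I) (hMc : ∀ m ∈ leftAnnihilator y, m * c ∈ I) : I ⋖ Ideal.span {c} ⊔ I := by
  refine ⟨lt_of_le_of_ne le_sup_right fun h =>
      hcI (h ▸ Submodule.mem_sup_left (Ideal.mem_span_singleton_self c)), fun X hIX hXJ => ?_⟩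
  obtain ⟨x, hxX, hxI⟩ := SetLike.exists_of_lt hIX
  obtain ⟨s, i, hi, rfl⟩ := Ideal.mem_span_singleton_sup.1 (hXJ.le hxX)
  obtain ⟨t, ht, -⟩ := exists_mul_sub_one_mem hy hmin hce
    fun hs => hxI (add_mem (hMc s hs) hi)
  have hcX : c ∈ X := by
    have : c = t * (s * c + i) - (t * s - 1) * c - t * i := by noncomm_ring
    rw [this]
    exact sub_mem (sub_mem (X.mul_mem_left t hxX) (hIX.le (hMc _ ht))) (hIX.le (I.mul_mem_left t hi))
  exact hXJ.not_ge (sup_le ((Ideal.span_singleton_le_iff_mem X).2 hcX) hIX.le)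

include hy hmin in
theorem covBy_toRight_span_sup (hce : FactorsCentrallyEssential R) {I : Ideal R} [I.IsTwoSided]
    {c : R} (hc : IsCentralModulo I c) (hcI : c ∉ I) (hMc : ∀ m ∈ leftAnnihilator y, m * c ∈ I)
    [(Ideal.span {c} ⊔ I).IsTwoSided] : I.toRight ⋖ (Ideal.span {c} ⊔ I).toRight := by
  refine ⟨(covBy_span_sup hy hmin hce hcI hMc).lt, fun X hIX hXJ => ?_⟩
  have hIX' : ∀ i ∈ I, i ∈ X := hIX.le
  have hmul : ∀ x ∈ X, ∀ r, x * r ∈ X := fun x hx r => X.smul_mem (MulOpposite.op r) hx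
  obtain ⟨x, hxX, hxI⟩ := SetLike.exists_of_lt hIX
  obtain ⟨s, i, hi, rfl⟩ := Ideal.mem_span_singleton_sup.1 (hXJ.le hxX)
  obtain ⟨t, -, ht⟩ := exists_mul_sub_one_mem hy hmin hce
    fun hs => hxI (add_mem (hMc s hs) hi)
  have hcX : c ∈ X := by
    have : c = (s * c + i) * t - s * (c * t - t * c) - (s * t - 1) * c - i * t := by
      noncomm_ring
    rw [this]
    exact sub_mem (sub_mem (sub_mem (hmul _ hxX t) (hIX' _ (I.mul_mem_left s (hc t))))
      (hIX' _ (hMc _ ht))) (hIX' _ (I.mul_mem_right t hi))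
  refine hXJ.not_ge fun z hz => ?_
  obtain ⟨s, i, hi, rfl⟩ := Ideal.mem_span_singleton_sup.1 hz
  have : s * c + i = c * s - (c * s - s * c) + i := by noncomm_ring
  rw [this]
  exact add_mem (sub_mem (hmul c hcX s) (hIX' _ (hc s))) (hIX' i hi)

/-- If a power of `M` vanishes, every proper two-sided ideal `I` admits an element outside `I` that
is central modulo `I` and annihilated by `M` modulo `I`: it is found in the last power of `M` not
contained in `I`. -/
theorem exists_isCentralModulo_mul_mem (hce : FactorsCentrallyEssential R) {M : Ideal R}
    [M.IsTwoSided] {k : ℕ} (hk : M ^ k = ⊥) {I : Ideal R} [I.IsTwoSided] (hI : I ≠ ⊤) :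
    ∃ c ∉ I, IsCentralModulo I c ∧ ∀ m ∈ M, m * c ∈ I := by
  classical
  have hex : ∃ n, M ^ n ≤ I := ⟨k, hk ▸ bot_le⟩
  obtain ⟨j, hj⟩ : ∃ j, Nat.find hex = j + 1 := Nat.exists_eq_succ_of_ne_zero fun h0 => hI <| by
    have := Nat.find_spec hex
    rwa [h0, Submodule.pow_zero, Ideal.one_eq_top, top_le_iff] at this
  have hle : M ^ (j + 1) ≤ I := hj ▸ Nat.find_spec hex
  obtain ⟨c, hcJ, hcI, hc⟩ := hce.exists_isCentralModulo (Nat.find_min hex (m := j) (by omega))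
  refine ⟨c, hcI, hc, fun m hm => hle ?_⟩
  rw [Ideal.IsTwoSided.pow_succ]
  exact Ideal.mul_mem_mul hm hcJ

include hy hy0 hmin in
theorem isFiniteLength_of_mem_ideals (hR : IsRightNoetherian R)
    (hce : FactorsCentrallyEssential R) : IsFiniteLength R R ∧ IsFiniteLength Rᵐᵒᵖ R := by
  have := isTwoSided_leftAnnihilator hy
  obtain ⟨k, hk⟩ := exists_pow_eq_bot hy hy0 hmin hR hce
  have key : ∀ (I : Ideal R) [I.IsTwoSided], IsFiniteLength R I → IsFiniteLength Rᵐᵒᵖ I.toRight →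
      IsFiniteLength R R ∧ IsFiniteLength Rᵐᵒᵖ R := by
    intro I hI
    refine hR.twoSided_induction (P := fun I => ∀ _ : I.IsTwoSided, IsFiniteLength R I →
      IsFiniteLength Rᵐᵒᵖ I.toRight → IsFiniteLength R R ∧ IsFiniteLength Rᵐᵒᵖ R) ?_ I hI
    intro I _ ih _ hl hr
    by_cases htop : I = ⊤
    · subst htop
      have h : (⊤ : Ideal R).toRight = ⊤ := rfl
      rw [h] at hr
      exact ⟨Submodule.topEquiv.isFiniteLength hl, Submodule.topEquiv.isFiniteLength hr⟩
    obtain ⟨c, hcI, hc, hMc⟩ := exists_isCentralModulo_mul_mem hce hk htop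
    have := hc.isTwoSided_span_sup
    have hcov := covBy_span_sup hy hmin hce hcI hMc
    exact ih _ hcov.lt this (hl.of_covBy hcov)
      (hr.of_covBy (covBy_toRight_span_sup hy hmin hce hc hcI hMc))
  have hbot : (⊥ : Ideal R).toRight = ⊥ := rfl
  exact key ⊥ .of_subsingleton (by rw [hbot]; exact .of_subsingleton)

end

/-! ### Subdirect decomposition -/

theorem IsRightNoetherian.exists_maximal_not_mem {R : Type*} [Ring R] (hR : IsRightNoetherian R)
    {a : R} (ha : a ≠ 0) :
    ∃ I : Ideal R, I.IsTwoSided ∧ a ∉ I ∧ ∀ (J : Ideal R) [J.IsTwoSided], I < J → a ∈ J := by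
  by_contra! h
  suffices h0 : a ∈ (⊥ : Ideal R) from ha (by simpa using h0)
  refine hR.twoSided_induction (P := fun I => a ∈ I) (fun I hI ih => ?_) ⊥
  by_contra haI
  obtain ⟨J, hJ, hIJ, haJ⟩ := h I hI haI
  exact haJ (ih J hIJ)

/-- A right Noetherian ring with centrally essential factor rings is local and Artinian on both
sides as soon as some nonzero element lies in all of its nonzero two-sided ideals. -/
theorem isLocalRing_and_isArtinian {S : Type*} [Ring S] (hS : IsRightNoetherian S)
    (hce : FactorsCentrallyEssential S) {a : S} (ha : a ≠ 0)
    (hmin : ∀ (J : Ideal S) [J.IsTwoSided], J ≠ ⊥ → a ∈ J) :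
    IsLocalRing S ∧ IsRightArtinian S ∧ IsLeftArtinian S := by
  have hbot : ∀ {x : S}, IsCentralModulo ⊥ x → x ∈ Subring.center S := fun hx =>
    Subring.mem_center_iff.2 fun r => (sub_eq_zero.1 (Ideal.mem_bot.1 (hx r))).symm
  obtain ⟨x, -, hax, hne⟩ := hce ⊥ a (by simpa using ha)
  have hy0 : a * x ≠ 0 := by simpa using hne
  have hmin' : ∀ (J : Ideal S) [J.IsTwoSided], J ≠ ⊥ → a * x ∈ J := fun J _ hJ =>
    J.mul_mem_right x (hmin J hJ)
  obtain ⟨hl, hr⟩ := isFiniteLength_of_mem_ideals (hbot hax) hy0 hmin' hS hce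
  exact ⟨isLocalRing_of_mem_ideals (hbot hax) hy0 hmin' hS hce,
    (isFiniteLength_iff_isNoetherian_isArtinian.1 hr).2,
    (isFiniteLength_iff_isNoetherian_isArtinian.1 hl).2⟩

theorem theorem1p5 {R : Type u} [Ring R] (hR : IsRightNoetherian R)
    (hfac : ∀ (I : Ideal R) [I.IsTwoSided], IsCentrallyEssential (R ⧸ I)) :
    ∃ (ι : Type u) (S : ι → Type u) (_ : ∀ i, Ring (S i)),
      (∀ i, IsLocalRing (S i) ∧ IsRightArtinian (S i) ∧ IsLeftArtinian (S i)) ∧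
        IsSubdirectProduct R S := by
  have hce := factorsCentrallyEssential_of_quotients hfac
  choose I hI haI hmax using fun a : {a : R // a ≠ 0} => hR.exists_maximal_not_mem a.2
  refine ⟨{a : R // a ≠ 0}, fun a => R ⧸ I a, fun a => Ideal.Quotient.ring (I a),
    fun a => ?_, RingHom.pi fun a => Ideal.Quotient.mk (I a), ?_,
    fun a => Ideal.Quotient.mk_surjective⟩
  · have hsurj := Ideal.Quotient.mk_surjective (I := I a)
    refine isLocalRing_and_isArtinian (hR.of_surjective _ hsurj) (hce.of_surjective _ hsurj)
      (a := Ideal.Quotient.mk (I a) a) (by rw [Ne, Ideal.Quotient.eq_zero_iff_mem]; exact haI a) ?_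
    intro J _ hJ
    refine hmax a (J.comap (Ideal.Quotient.mk (I a))) (lt_of_le_of_ne (fun x hx => ?_) fun h => ?_)
    · rw [Ideal.mem_comap, Ideal.Quotient.eq_zero_iff_mem.2 hx]
      exact J.zero_mem
    · refine hJ ((Submodule.eq_bot_iff J).2 fun s hs => ?_)
      obtain ⟨x, rfl⟩ := hsurj s
      rw [Ideal.Quotient.eq_zero_iff_mem, h]
      exact hs
  · refine (injective_iff_map_eq_zero _).2 fun a ha => ?_
    by_contra hne
    exact haI ⟨a, hne⟩ (Ideal.Quotient.eq_zero_iff_mem.1 (congrFun ha ⟨a, hne⟩))
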